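/- Let $n\ge 1$, let $k=p\,2^{q}$ with $p$ a positive odd integer and $q\ge 1$ an integer, and let $G$ be a complete balanced $k$-partite graph with $n$ vertices in each part; that is, $G$ is a finite simple graph whose vertex set can be partitioned into $k$ sets $V_1,\dots,V_k$ with $|V_1|=\dots=|V_k|=n$ such that two vertices are adjacent if and only if they belong to different sets $V_i$. Then for every integer $t$ with $$(k-1)n\le t\le (2k-p-q)n-1,$$ $G$ has an interval $t$-coloring, i.e. a map $\alpha$ from the edges of $G$ onto $\{1,\dots,t\}$ such that for every vertex $v$ the colors of the edges incident to $v$ are pairwise distinct and form an interval of consecutive integers. -/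

import Mathlib

namespace SimpleGraph

/-- `G` is a complete balanced `k`-partite graph with `n` vertices in each part: its vertices can
be partitioned into `k` classes `V₁, …, V_k` (the fibres of `part`), each with `n` vertices, such
that two vertices are adjacent if and only if they lie in different classes. -/
def IsCompleteBalancedMultipartite {V : Type*} (G : SimpleGraph V) (k n : ℕ) : Prop :=
  ∃ part : V → Fin k,
    (∀ i : Fin k, {v : V | part v = i}.ncard = n) ∧
    ∀ u v : V, G.Adj u v ↔ part u ≠ part v

/-- The set `S(v, α)` of colors appearing on the edges of `G` incident to the vertex `v`. -/
def colorsAt {V : Type*} (G : SimpleGraph V) (α : G.edgeSet → ℕ) (v : V) : Set ℕ :=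
  {c : ℕ | ∃ e : G.edgeSet, v ∈ (e : Sym2 V) ∧ α e = c}

/-- `α` is an interval `t`-coloring of the edges of `G`. -/
structure IsIntervalColoring {V : Type*} (G : SimpleGraph V) (t : ℕ) (α : G.edgeSet → ℕ) :
    Prop where
  /-- The colors are `1, …, t`, and all of them are used. -/
  range_eq : Set.range α = Set.Icc 1 t
  /-- The colors of the edges incident to each vertex are distinct. -/
  proper : ∀ (v : V) (e e' : G.edgeSet), v ∈ (e : Sym2 V) → v ∈ (e' : Sym2 V) →
    e ≠ e' → α e ≠ α e'
  /-- The colors of the edges incident to each vertex form an interval of integers. -/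
  interval : ∀ v : V, ∃ a b : ℕ, G.colorsAt α v = Set.Icc a b

end SimpleGraph

/-!
Color the edges of a `d`-regular graph so that the edges at each vertex `v` receive the `d`
consecutive labels starting at some `a v`, the labels in total being `0, …, t - 1`. As long as
`d < t`, replacing the largest label `t - 1` by `t - 1 - d` gives such a labeling with one label
less, so only the largest value of `t` matters.

* On `K_{2m}`, split the vertices into two copies of `Fin m`. The prism formed by the two copies of
  `K_m` and the matching between them is labeled by `i + j`, so that every window contains the cut
  between `m - 1` and `m`. The remaining edges form `K_{m,m}` minus a matching, which splits into
  `m - 1` cyclic matchings; inserting their labels at the cut gives `3m - 2` labels.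
* Doubling every vertex of `K_k` turns `t` labels into `t + 2(k - 1) + 1`. Starting from `k = 2p`
  and doubling `q - 1` times, one reaches `2k - p - q - 1` labels for `k = p 2^q`.
* Replacing every vertex by `n` independent ones, the label `n c + i + j` between the `i`-th copy of
  one vertex and the `j`-th copy of another turns `t` labels into `n t + n - 1`.
-/

open SimpleGraph

theorem val_sub_pos {m : ℕ} [NeZero m] {i j : Fin m} (h : i ≠ j) : 0 < (i - j).val :=
  Nat.pos_of_ne_zero fun h0 => h (sub_eq_zero.1 (Fin.ext h0))

theorem compl_top_boxProd_top_adj {α β : Type*} {u v : α × β} :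
    ((⊤ : SimpleGraph α) □ (⊤ : SimpleGraph β))ᶜ.Adj u v ↔ u.1 ≠ v.1 ∧ u.2 ≠ v.2 := by
  simp only [compl_adj, boxProd_adj, top_adj, ne_eq, Prod.ext_iff]
  tauto

/-- The lexicographic product `G[K₂]`: every vertex of `G` is replaced by two adjacent copies. -/
def vertexDoubling {V : Type*} (G : SimpleGraph V) : SimpleGraph (Bool × V) :=
  G.comap Prod.snd ⊔ (⊤ : SimpleGraph Bool) □ (⊥ : SimpleGraph V)

theorem vertexDoubling_adj {V : Type*} {G : SimpleGraph V} {u v : Bool × V} :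
    (vertexDoubling G).Adj u v ↔ G.Adj u.2 v.2 ∨ u.1 ≠ v.1 ∧ u.2 = v.2 := by
  simp only [vertexDoubling, sup_adj, comap_adj, boxProd_adj, top_adj, bot_adj, false_and, or_false]

theorem vertexDoubling_top {V : Type*} : vertexDoubling (⊤ : SimpleGraph V) = ⊤ := by
  ext u v
  simp only [vertexDoubling_adj, top_adj, ne_eq, Prod.ext_iff]
  tauto

/-- A labeling of the edges of `G` in which the edges at each vertex `v` get distinct labels from
the window of `d` consecutive integers starting at `start v`, the windows together covering exactly
the labels `0, …, t - 1`. In a `d`-regular graph this is an interval `t`-coloring, shifted by one.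
The values of `label` on pairs of non-adjacent vertices are irrelevant. -/
structure WindowLabeling {V : Type*} (G : SimpleGraph V) (d t : ℕ) where
  label : V → V → ℕ
  start : V → ℕ
  label_comm : ∀ {v w}, G.Adj v w → label v w = label w v
  start_le_label : ∀ {v w}, G.Adj v w → start v ≤ label v w
  label_lt_start_add : ∀ {v w}, G.Adj v w → label v w < start v + d
  injOn_label : ∀ v, Set.InjOn (label v) (G.neighborSet v)
  start_add_le : ∀ v, start v + d ≤ t
  exists_window : ∀ {x}, x < t → ∃ v, start v ≤ x ∧ x < start v + d

namespace WindowLabeling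

variable {V W : Type*} {G : SimpleGraph V} {d t : ℕ}

theorem label_lt (L : WindowLabeling G d t) {v w : V} (h : G.Adj v w) : L.label v w < t :=
  (L.label_lt_start_add h).trans_le (L.start_add_le v)

/-- The pullback of a window labeling along a graph isomorphism. -/
def ofIso {H : SimpleGraph W} (L : WindowLabeling H d t) (f : G ≃g H) :
    WindowLabeling G d t where
  label v w := L.label (f v) (f w)
  start v := L.start (f v)
  label_comm h := L.label_comm (f.map_adj_iff.2 h)
  start_le_label h := L.start_le_label (f.map_adj_iff.2 h)
  label_lt_start_add h := L.label_lt_start_add (f.map_adj_iff.2 h)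
  injOn_label v _ hw _ hw' h :=
    f.injective (L.injOn_label (f v) (f.map_adj_iff.2 hw) (f.map_adj_iff.2 hw') h)
  start_add_le v := L.start_add_le (f v)
  exists_window hx := by
    obtain ⟨w, hw⟩ := L.exists_window hx
    exact ⟨f.symm w, by simpa using hw⟩

/-- The window labeling with one label less in which the top label `t` is replaced by `t - d`,
the number just below every window containing `t`. -/
def dropTop (L : WindowLabeling G d (t + 1)) (hd : d ≤ t) : WindowLabeling G d t where
  label v w := if L.label v w = t then t - d else L.label v w
  start v := min (L.start v) (t - d)
  label_comm h := by rw [L.label_comm h]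
  start_le_label h := by
    have := L.start_le_label h
    split_ifs <;> omega
  label_lt_start_add {v w} h := by
    have := L.label_lt_start_add h
    have := L.start_le_label h
    have := L.start_add_le v
    split_ifs <;> omega
  injOn_label v w hw w' hw' h := by
    have := L.start_le_label hw
    have := L.label_lt_start_add hw
    have := L.start_le_label hw'
    have := L.label_lt_start_add hw'
    have := L.start_add_le v
    refine L.injOn_label v hw hw' ?_
    dsimp only at h
    split_ifs at h <;> omega
  start_add_le v := by omega
  exists_window {x} hx := by
    obtain ⟨v, hv⟩ := L.exists_window (x := x) (by omega)
    have := L.start_add_le v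
    exact ⟨v, by omega⟩

theorem nonempty_of_le {s : ℕ} (L : WindowLabeling G d t) (hds : d ≤ s) (hst : s ≤ t) :
    Nonempty (WindowLabeling G d s) := by
  induction t, hst using Nat.le_induction with
  | base => exact ⟨L⟩
  | succ t hst ih => exact ih (L.dropTop (hds.trans hst))

theorem image_label_neighborSet (L : WindowLabeling G d t) {v : V}
    (hd : (G.neighborSet v).ncard = d) :
    L.label v '' G.neighborSet v = Set.Ico (L.start v) (L.start v + d) := by
  refine Set.eq_of_subset_of_ncard_le ?_ ?_ (Set.finite_Ico _ _)
  · exact Set.image_subset_iff.2 fun w hw => ⟨L.start_le_label hw, L.label_lt_start_add hw⟩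
  · simp [(L.injOn_label v).ncard_image, hd, Set.ncard_eq_toFinset_card']

/-- The edge coloring with colors `1, 2, …` obtained from a window labeling. -/
def coloring (L : WindowLabeling G d t) : G.edgeSet → ℕ :=
  EdgeLabeling.mk (fun v w _ => L.label v w + 1) fun _ _ h => by rw [L.label_comm h]

theorem coloring_mk (L : WindowLabeling G d t) {v w : V} (h : G.Adj v w) :
    L.coloring ⟨s(v, w), h⟩ = L.label v w + 1 :=
  rfl

theorem colorsAt_coloring (L : WindowLabeling G d t) {v : V}
    (hd : (G.neighborSet v).ncard = d) :
    G.colorsAt L.coloring v = Set.Icc (L.start v + 1) (L.start v + d) := by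
  have colorsAt_eq : G.colorsAt L.coloring v = (· + 1) '' (L.label v '' G.neighborSet v) := by
    ext x
    constructor
    · rintro ⟨⟨e, he⟩, ⟨w, rfl⟩, rfl⟩
      exact ⟨_, ⟨w, he, rfl⟩, rfl⟩
    · rintro ⟨_, ⟨w, hw, rfl⟩, rfl⟩
      exact ⟨⟨s(v, w), hw⟩, Sym2.mem_mk_left v w, rfl⟩
  rw [colorsAt_eq, L.image_label_neighborSet hd, Set.image_add_const_Ico]
  ext x
  simp only [Set.mem_Ico, Set.mem_Icc]
  omega

theorem isIntervalColoring (L : WindowLabeling G d t)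
    (hd : ∀ v, (G.neighborSet v).ncard = d) : G.IsIntervalColoring t L.coloring where
  range_eq := by
    ext x
    constructor
    · rintro ⟨⟨e, he⟩, rfl⟩
      induction e using Sym2.ind with
      | _ v w =>
        rw [L.coloring_mk he]
        exact ⟨Nat.le_add_left _ _, L.label_lt he⟩
    · rintro ⟨hx, hxt⟩
      obtain ⟨v, hv⟩ := L.exists_window (x := x - 1) (by omega)
      have hxv : x ∈ G.colorsAt L.coloring v := by
        rw [L.colorsAt_coloring (hd v), Set.mem_Icc]
        omega
      obtain ⟨e, -, he⟩ := hxv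
      exact ⟨e, he⟩
  proper := by
    rintro v ⟨_, hw⟩ ⟨_, hw'⟩ ⟨w, rfl⟩ ⟨w', rfl⟩ hne heq
    rw [L.coloring_mk hw, L.coloring_mk hw', add_left_inj] at heq
    obtain rfl := L.injOn_label v hw hw' heq
    exact hne rfl
  interval v := ⟨_, _, L.colorsAt_coloring (hd v)⟩

open Classical in
/-- The window labeling of `G ⊔ H` that inserts the `r` labels of `M` into the labels of `L` just
below `s`. An `(r, r)`-labeling is a proper edge coloring with `r` colors. -/
noncomputable def insertAt {H : SimpleGraph V} {r : ℕ} (L : WindowLabeling G d t)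
    (M : WindowLabeling H r r) (s : ℕ) (hs : ∀ v, L.start v ≤ s ∧ s ≤ L.start v + d) :
    WindowLabeling (G ⊔ H) (d + r) (t + r) where
  label v w :=
    if G.Adj v w then if L.label v w < s then L.label v w else L.label v w + r
    else s + M.label v w
  start := L.start
  label_comm {v w} h := by
    by_cases hG : G.Adj v w
    · simp only [hG, hG.symm, if_true, L.label_comm hG]
    · have hG' : ¬G.Adj w v := fun h => hG h.symm
      simp only [hG, hG', if_false, M.label_comm (h.resolve_left hG)]
  start_le_label {v w} _ := by
    have := hs v
    have := @L.start_le_label v w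
    grind
  label_lt_start_add {v w} h := by
    have := hs v
    by_cases hG : G.Adj v w
    · have := L.label_lt_start_add hG
      grind
    · have := M.label_lt (h.resolve_left hG)
      grind
  injOn_label v w hw w' hw' h := by
    by_cases hG : G.Adj v w <;> by_cases hG' : G.Adj v w' <;>
      simp only [hG, hG', if_true, if_false] at h
    · exact L.injOn_label v hG hG' (by grind)
    · have := M.label_lt (hw'.resolve_left hG')
      grind
    · have := M.label_lt (hw.resolve_left hG)
      grind
    · exact M.injOn_label v (hw.resolve_left hG) (hw'.resolve_left hG') (by omega)
  start_add_le v := by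
    have := L.start_add_le v
    omega
  exists_window {x} hx := by
    by_cases hxt : x < t
    · obtain ⟨v, hv⟩ := L.exists_window hxt
      exact ⟨v, by omega⟩
    by_cases hxr : x < r
    · obtain ⟨v, -⟩ := M.exists_window hxr
      have := L.start_add_le v
      exact ⟨v, by omega⟩
    · obtain ⟨v, hv⟩ := L.exists_window (x := x - r) (by omega)
      exact ⟨v, by omega⟩

/-- The labeling of two copies of `K_m` joined by a perfect matching by `i + j`. -/
def prism (m : ℕ) :
    WindowLabeling ((⊤ : SimpleGraph Bool) □ (⊤ : SimpleGraph (Fin m))) m (2 * m - 1) where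
  label u v := u.2 + v.2
  start u := u.2
  label_comm _ := add_comm _ _
  start_le_label _ := Nat.le_add_right _ _
  label_lt_start_add {_ v} _ := Nat.add_lt_add_left v.2.isLt _
  injOn_label := by
    rintro ⟨b, i⟩ ⟨b', j⟩ h ⟨b'', l⟩ h' hjl
    obtain rfl : j = l := Fin.ext (by simpa using hjl)
    simp only [mem_neighborSet, boxProd_adj, top_adj] at h h'
    cases b <;> cases b' <;> cases b'' <;> simp_all
  start_add_le u := by omega
  exists_window {x} hx := ⟨(false, ⟨min x (m - 1), by omega⟩), by dsimp only; omega⟩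

/-- The decomposition of `K_{m,m}` minus a perfect matching into `m - 1` cyclic matchings, the edge
between `(false, i)` and `(true, j)` being labeled by `j - i - 1` modulo `m`. -/
def cyclicMatchings (m : ℕ) [NeZero m] :
    WindowLabeling ((⊤ : SimpleGraph Bool) □ (⊤ : SimpleGraph (Fin m)))ᶜ (m - 1) (m - 1) where
  label u v := (if u.1 then u.2 - v.2 else v.2 - u.2).val - 1
  start _ := 0
  label_comm {u v} h := by
    have := (compl_top_boxProd_top_adj.1 h).1
    obtain ⟨_ | _, i⟩ := u <;> obtain ⟨_ | _, j⟩ := v <;> simp_all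
  start_le_label _ := Nat.zero_le _
  label_lt_start_add {u v} h := by
    have hne := (compl_top_boxProd_top_adj.1 h).2
    have := val_sub_pos hne
    have := val_sub_pos hne.symm
    split_ifs <;> omega
  injOn_label := by
    rintro ⟨b, i⟩ ⟨b', j⟩ h ⟨b'', l⟩ h' hjl
    obtain ⟨hb, hj⟩ := compl_top_boxProd_top_adj.1 h
    obtain ⟨hb', hl⟩ := compl_top_boxProd_top_adj.1 h'
    have hb_eq : b' = b'' := by grind
    have hj_eq : j = l := by
      have := val_sub_pos hj
      have := val_sub_pos hj.symm
      have := val_sub_pos hl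
      have := val_sub_pos hl.symm
      cases b
      · exact sub_left_injective (Fin.ext (by grind : (j - i).val = (l - i).val))
      · exact sub_right_injective (Fin.ext (by grind : (i - j).val = (i - l).val))
    rw [hb_eq, hj_eq]
  start_add_le _ := by omega
  exists_window {x} hx := ⟨(false, 0), by omega⟩

/-- A window labeling of `K_{2m}` with `3m - 2` labels. -/
noncomputable def topBoolProdFin (m : ℕ) [NeZero m] :
    WindowLabeling (⊤ : SimpleGraph (Bool × Fin m)) (m + (m - 1)) (2 * m - 1 + (m - 1)) :=
  sup_compl_eq_top (x := (⊤ : SimpleGraph Bool) □ (⊤ : SimpleGraph (Fin m))) ▸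
    (prism m).insertAt (cyclicMatchings m) m fun u => ⟨u.2.isLt.le, Nat.le_add_left _ _⟩

open Classical in
/-- The labeling of `G[K₂]` in which, with `a = start v`, the edges from the first copy of `v` to
first copies, to second copies and to its twin get labels in `[a, a + d)`, in `[a + d, a + 2 * d)`
and equal to `a + 2 * d`, and those from the second copy to first copies, to its twin and to second
copies get labels in `[a + d, a + 2 * d)`, equal to `a + 2 * d` and in
`[a + 2 * d + 1, a + 3 * d + 1)`. -/
noncomputable def double [Nonempty V] (L : WindowLabeling G d t) :
    WindowLabeling (vertexDoubling G) (2 * d + 1) (t + 2 * d + 1) where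
  label u v :=
    if G.Adj u.2 v.2 then
      L.label u.2 v.2 + if u.1 = v.1 then if u.1 then 2 * d + 1 else 0 else d
    else L.start u.2 + 2 * d
  start u := L.start u.2 + if u.1 then d else 0
  label_comm {u v} h := by
    have := L.label_comm (v := u.2) (w := v.2)
    have := G.adj_comm u.2 v.2
    have := vertexDoubling_adj.1 h
    grind
  start_le_label {u v} h := by
    have := L.start_le_label (v := u.2) (w := v.2)
    have := vertexDoubling_adj.1 h
    grind
  label_lt_start_add {u v} h := by
    have := L.label_lt_start_add (v := u.2) (w := v.2)
    have := vertexDoubling_adj.1 h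
    grind
  injOn_label := by
    rintro ⟨b, u⟩ ⟨b', v⟩ h ⟨b'', w⟩ h' hvw
    have := vertexDoubling_adj.1 h
    have := vertexDoubling_adj.1 h'
    have hv (h : G.Adj u v) := And.intro (L.start_le_label h) (L.label_lt_start_add h)
    have hw (h : G.Adj u w) := And.intro (L.start_le_label h) (L.label_lt_start_add h)
    have inj (hv : G.Adj u v) (hw : G.Adj u w) := L.injOn_label u hv hw
    cases b <;> cases b' <;> cases b'' <;> grind
  start_add_le u := by
    have := L.start_add_le u.2
    grind
  exists_window {x} hx := by
    by_cases hxt : x < t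
    · obtain ⟨v, hv⟩ := L.exists_window hxt
      exact ⟨(false, v), by grind⟩
    by_cases hxd : x < 2 * d + 1
    · obtain ⟨v⟩ := ‹Nonempty V›
      have := L.start_add_le v
      exact ⟨(false, v), by grind⟩
    · obtain ⟨v, hv⟩ := L.exists_window (x := x - (2 * d + 1)) (by omega)
      exact ⟨(true, v), by grind⟩

/-- The labeling by `n * c + i + j` of the graph obtained from `G` by replacing every vertex by
`n` independent copies. -/
def blowup (L : WindowLabeling G d t) (ht : 0 < t) (n : ℕ) [NeZero n] :
    WindowLabeling (G.comap (Prod.fst : V × Fin n → V)) (n * d) (n * t + n - 1) where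
  label u v := n * L.label u.1 v.1 + u.2 + v.2
  start u := n * L.start u.1 + u.2
  label_comm h := by rw [L.label_comm h, Nat.add_right_comm]
  start_le_label {u v} h := by
    have := Nat.mul_le_mul_left n (L.start_le_label h)
    omega
  label_lt_start_add {u v} h := by
    have := Nat.mul_le_mul_left n (Nat.succ_le_of_lt (L.label_lt_start_add h))
    grind
  injOn_label := by
    rintro ⟨u, i⟩ ⟨v, j⟩ h ⟨w, l⟩ h' hvw
    have label_add_eq : n * L.label u v + j = n * L.label u w + l := by grind
    have label_eq : L.label u v = L.label u w := by
      simpa [Nat.mul_add_div (NeZero.pos n), Nat.div_eq_of_lt] using congrArg (· / n) label_add_eq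
    have hjl : j = l := by
      simpa [Nat.mod_eq_of_lt, Fin.val_inj] using congrArg (· % n) label_add_eq
    exact Prod.ext (L.injOn_label u h h' label_eq) hjl
  start_add_le u := by
    have := Nat.mul_le_mul_left n (L.start_add_le u.1)
    grind
  exists_window {x} hx := by
    have n_pos : 0 < n := NeZero.pos n
    by_cases hxt : x < n * t
    · obtain ⟨v, hv, hv'⟩ := L.exists_window (Nat.div_lt_of_lt_mul hxt)
      have := Nat.mul_div_le x n
      have := Nat.lt_mul_of_div_lt hv' n_pos
      have := Nat.mul_le_mul_left n hv
      exact ⟨(v, 0), by grind⟩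
    · obtain ⟨v, hv, hv'⟩ := L.exists_window (x := t - 1) (by omega)
      have := L.start_add_le v
      have := Nat.mul_le_mul_left n (show L.start v + 1 ≤ t by omega)
      have top_eq : n * (L.start v + d) = n * t := by
        rw [show L.start v + d = t by omega]
      exact ⟨(v, ⟨n - 1, by omega⟩), by grind⟩

end WindowLabeling

theorem exists_windowLabeling_top_fin {k p q : ℕ} (hp : 0 < p) (hq : 1 ≤ q) (hk : k = p * 2 ^ q) :
    ∃ t > 0, t + p + q + 1 = 2 * k ∧
      Nonempty (WindowLabeling (⊤ : SimpleGraph (Fin k)) (k - 1) t) := by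
  induction q, hq using Nat.le_induction generalizing k with
  | base =>
    have : NeZero p := ⟨hp.ne'⟩
    let e : Fin k ≃ Bool × Fin p := Fintype.equivOfCardEq (by simp [hk, mul_comm])
    have L := (WindowLabeling.topBoolProdFin p).ofIso (Iso.completeGraph e)
    refine ⟨2 * p - 1 + (p - 1), by omega, by omega, ⟨?_⟩⟩
    rwa [show p + (p - 1) = k - 1 by omega] at L
  | succ q _ ih =>
    obtain ⟨t, -, ht, ⟨L⟩⟩ := ih rfl
    have half_pos : 0 < p * 2 ^ q := by positivity
    have : NeZero (p * 2 ^ q) := ⟨half_pos.ne'⟩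
    have k_eq : k = 2 * (p * 2 ^ q) := by rw [hk, pow_succ, mul_comm 2, mul_assoc]
    let e : Fin k ≃ Bool × Fin (p * 2 ^ q) := Fintype.equivOfCardEq (by simp [k_eq])
    have L' := L.double
    rw [vertexDoubling_top, show 2 * (p * 2 ^ q - 1) + 1 = k - 1 by omega] at L'
    exact ⟨_, Nat.succ_pos _, by omega, ⟨L'.ofIso (Iso.completeGraph e)⟩⟩

theorem nonempty_iso_completeEquipartiteGraph {V : Type*} {G : SimpleGraph V} {k n : ℕ}
    (hG : G.IsCompleteBalancedMultipartite k n) (hn : n ≠ 0) :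
    Nonempty (G ≃g completeEquipartiteGraph k n) := by
  obtain ⟨part, hcard, hadj⟩ := hG
  have equivFin (i : Fin k) : {v // part v = i} ≃ Fin n :=
    have : Finite {v // part v = i} := Nat.finite_of_card_ne_zero ((hcard i).trans_ne hn)
    Finite.equivFinOfCardEq (hcard i)
  let e : V ≃ Fin k × Fin n := (Equiv.sigmaFiberEquiv part).symm.trans
    ((Equiv.sigmaCongrRight equivFin).trans (Equiv.sigmaEquivProd _ _))
  exact ⟨e, (hadj _ _).symm⟩

theorem ncard_neighborSet_of_iso_completeEquipartiteGraph {V : Type*} {G : SimpleGraph V}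
    {k n : ℕ} (φ : G ≃g completeEquipartiteGraph k n) (v : V) :
    (G.neighborSet v).ncard = (k - 1) * n := by
  rw [← Nat.card_coe_set_eq, Nat.card_congr (φ.mapNeighborSet v), Nat.card_coe_set_eq,
    neighborSet_completeEquipartiteGraph, Set.ncard_prod, Set.ncard_compl]
  simp

theorem corollary2p3_general {V : Type*} (G : SimpleGraph V) (k n p q t : ℕ)
    (hG : G.IsCompleteBalancedMultipartite k n)
    (hp : 0 < p) (hq : 1 ≤ q) (hk : k = p * 2 ^ q)
    (ht_lower : ((k : ℤ) - 1) * n ≤ t)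
    (ht_upper : (t : ℤ) ≤ (2 * (k : ℤ) - p - q) * n - 1) :
    ∃ α : G.edgeSet → ℕ, G.IsIntervalColoring t α := by
  have hn : n ≠ 0 := by
    rintro rfl
    rw [Nat.cast_zero, mul_zero] at ht_upper
    omega
  have : NeZero n := ⟨hn⟩
  obtain ⟨T, T_pos, hT, ⟨L⟩⟩ := exists_windowLabeling_top_fin hp hq hk
  obtain ⟨φ⟩ := nonempty_iso_completeEquipartiteGraph hG hn
  have lower : n * (k - 1) ≤ t := by
    zify [show 1 ≤ k by omega]
    linarith
  have upper : t ≤ n * T + n - 1 := by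
    have T_eq : 2 * (k : ℤ) - p - q = T + 1 := by omega
    rw [T_eq] at ht_upper
    zify [show 1 ≤ n * T + n by omega]
    linarith
  obtain ⟨L'⟩ := ((L.blowup T_pos n).ofIso φ).nonempty_of_le lower upper
  exact ⟨L'.coloring, L'.isIntervalColoring fun v => by
    rw [ncard_neighborSet_of_iso_completeEquipartiteGraph φ v, mul_comm]⟩

theorem corollary2p3 {V : Type*} [Finite V] (G : SimpleGraph V) (k n p q t : ℕ)
    (hn : 1 ≤ n) (hG : G.IsCompleteBalancedMultipartite k n)
    (hp : Odd p) (hq : 1 ≤ q) (hk : k = p * 2 ^ q)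
    (ht_lower : ((k : ℤ) - 1) * n ≤ t)
    (ht_upper : (t : ℤ) ≤ (2 * (k : ℤ) - p - q) * n - 1) :
    ∃ α : G.edgeSet → ℕ, G.IsIntervalColoring t α :=
  corollary2p3_general G k n p q t hG hp.pos hq hk ht_lower ht_upper
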